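/- Let $\Omega\subset\mathbb C^m$ be a non-empty bounded connected open set. A commuting $m$-tuple $\boldsymbol T=(T_1,\dots,T_m)$ of bounded linear operators on a separable complex Hilbert space $\mathcal H$ belongs to $B_1(\Omega)$ if, for $D_{\boldsymbol T-w}:\mathcal H\to\mathcal H\oplus\cdots\oplus\mathcal H$, $D_{\boldsymbol T-w}x=((T_1-w_1)x,\dots,(T_m-w_m)x)$, the range of $D_{\boldsymbol T-w}$ is closed and $\dim\ker D_{\boldsymbol T-w}=1$ for every $w\in\Omega$, and the linear span of $\bigcup_{w\in\Omega}\ker D_{\boldsymbol T-w}$ is dense in $\mathcal H$. For $w\in\Omega$ put $$\mathcal N(w)=\bigcap_{i,j=1}^m\ker (T_i-w_iI)(T_j-w_jI),\qquad N_k(w)=(T_k-w_kI)|_{\mathcal N(w)}:\mathcal N(w)\to\mathcal N(w)\quad(1\le k\le m).$$ Let $\boldsymbol T$ on $\mathcal H$ and $\tilde{\boldsymbol T}$ on $\tilde{\mathcal H}$ be in $B_1(\Omega)$, with local operators $N_k(w)$ on $\mathcal N(w)$ and $\tilde N_k(w)$ on $\tilde{\mathcal N}(w)$. (1) $\boldsymbol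 T$ and $\tilde{\boldsymbol T}$ are unitarily equivalent (there is a unitary $U:\mathcal H\to\tilde{\mathcal H}$ with $UT_k=\tilde T_kU$ for all $k$) if and only if there is a non-empty open set $\Omega_0\subseteq\Omega$ such that for every $w\in\Omega_0$ the tuples $(N_1(w),\dots,N_m(w))$ and $(\tilde N_1(w),\dots,\tilde N_m(w))$ are simultaneously unitarily equivalent, that is, there is a unitary $U_w:\mathcal N(w)\to\tilde{\mathcal N}(w)$ with $U_wN_k(w)=\tilde N_k(w)U_w$ for all $1\le k\le m$. (2) Every point of $\Omega$ has an open neighbourhood $V\subseteq\Omega$ on which there is a holomorphic frame, that is, a holomorphic map $\gamma:V\to\mathcal H$ such that $\gamma(w)\neq0$ spans $\ker D_{\boldsymbol T-w}$ for each $w\in V$. For every open $V\subseteq\Omega$, every holomorphic frame $\gamma$ on $V$ and every $w\in V$, the curvature matrix $$\mathcal K_{\boldsymbol T}(w)=\Big(-\frac{\partial^2}{\partial w_i\,\partial\bar w_j}\log\|\gamma(w)\|^2\Big)_{i,j=1}^m$$ is invertible and $$\big(-\mathcal K_{\boldsymbol T}(w)^{\mathrm t}\big)^{-1}=\Big(\operatorname{tr}\big(N_k(w)N_j(w)^*\big)\Big)_{k,j=1}^m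 .$$ -/

import Mathlib

noncomputable section

namespace CowenDouglas

variable {m : ℕ} {H : Type*} [NormedAddCommGroup H] [InnerProductSpace ℂ H]

/-- The operator `T_i - w_i I`. -/
def shifted (T : Fin m → H →L[ℂ] H) (w : Fin m → ℂ) (i : Fin m) : H →L[ℂ] H :=
  T i - w i • ContinuousLinearMap.id ℂ H

/-- The operator `D_{T-w} : H → H ⊕ ⋯ ⊕ H`, `x ↦ ((T_1 - w_1) x, …, (T_m - w_m) x)`.
Only the topology of the direct sum matters below, and this is the product topology. -/
def D (T : Fin m → H →L[ℂ] H) (w : Fin m → ℂ) : H →L[ℂ] (Fin m → H) :=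
  ContinuousLinearMap.pi (shifted T w)

/-- The `m`-tuple `T` of bounded operators is commuting and belongs to the
Cowen-Douglas class `B_n(Ω)`. -/
structure MemClass (n : ℕ) (Ω : Set (Fin m → ℂ)) (T : Fin m → H →L[ℂ] H) : Prop where
  commute : ∀ i j, Commute (T i) (T j)
  isClosed_range : ∀ w ∈ Ω, IsClosed (Set.range (D T w))
  dense_span : Dense
    ((⨆ w ∈ Ω, LinearMap.ker (D T w : H →ₗ[ℂ] (Fin m → H)) : Submodule ℂ H) : Set H)
  rank_ker : ∀ w ∈ Ω, Module.rank ℂ (LinearMap.ker (D T w : H →ₗ[ℂ] (Fin m → H))) = n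

/-- Unitary equivalence of two `m`-tuples of operators: one unitary intertwines
all the `m` pairs simultaneously. -/
def UnitarilyEquivalent {E F : Type*} [NormedAddCommGroup E] [InnerProductSpace ℂ E]
    [NormedAddCommGroup F] [InnerProductSpace ℂ F]
    (A : Fin m → E →L[ℂ] E) (B : Fin m → F →L[ℂ] F) : Prop :=
  ∃ U : E ≃ₗᵢ[ℂ] F, ∀ k x, U (A k x) = B k (U x)

/-- The space `𝒩(w) = ⋂_{i,j} ker (T_i - w_i I)(T_j - w_j I)`. -/
def localSpace (T : Fin m → H →L[ℂ] H) (w : Fin m → ℂ) : Submodule ℂ H :=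
  ⨅ i, ⨅ j, LinearMap.ker ((shifted T w i ∘L shifted T w j : H →L[ℂ] H) : H →ₗ[ℂ] H)

theorem mem_localSpace {T : Fin m → H →L[ℂ] H} {w : Fin m → ℂ} {x : H} :
    x ∈ localSpace T w ↔ ∀ i j, shifted T w i (shifted T w j x) = 0 := by
  simp [localSpace, Submodule.mem_iInf]

theorem isClosed_localSpace (T : Fin m → H →L[ℂ] H) (w : Fin m → ℂ) :
    IsClosed (localSpace T w : Set H) := by
  have h : (localSpace T w : Set H) =
      ⋂ i, ⋂ j, {x | shifted T w i (shifted T w j x) = 0} := by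
    ext x
    simp [mem_localSpace]
  rw [h]
  exact isClosed_iInter fun i => isClosed_iInter fun j =>
    isClosed_eq ((shifted T w i).continuous.comp (shifted T w j).continuous) continuous_const

instance [CompleteSpace H] (T : Fin m → H →L[ℂ] H) (w : Fin m → ℂ) :
    CompleteSpace (localSpace T w) :=
  (isClosed_localSpace T w).completeSpace_coe

theorem shifted_mem_localSpace (T : Fin m → H →L[ℂ] H) (w : Fin m → ℂ) (k : Fin m)
    (x : localSpace T w) : shifted T w k (x : H) ∈ localSpace T w := by
  rw [mem_localSpace]
  intro i j
  rw [mem_localSpace.mp x.2 j k, map_zero]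

/-- The local operator `N_k(w) = (T_k - w_k I)|_{𝒩(w)}`, as an operator on `𝒩(w)`. -/
def localOp (T : Fin m → H →L[ℂ] H) (w : Fin m → ℂ) (k : Fin m) :
    localSpace T w →L[ℂ] localSpace T w :=
  (shifted T w k ∘L (localSpace T w).subtypeL).codRestrict (localSpace T w)
    (fun x => shifted_mem_localSpace T w k x)

/-- The matrix `(tr (N_k(w) N_j(w)^*))_{k,j}`. -/
def traceMatrix [CompleteSpace H] (T : Fin m → H →L[ℂ] H) (w : Fin m → ℂ) :
    Matrix (Fin m) (Fin m) ℂ :=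
  Matrix.of fun k j => LinearMap.trace ℂ (localSpace T w)
    ((localOp T w k ∘L ContinuousLinearMap.adjoint (localOp T w j) :
      localSpace T w →L[ℂ] localSpace T w) : localSpace T w →ₗ[ℂ] localSpace T w)

/-- `γ` is a holomorphic frame, over the open set `V`, of the line bundle of joint
eigenspaces `ker D_{T-w}`. -/
structure IsHolomorphicFrame (T : Fin m → H →L[ℂ] H) (V : Set (Fin m → ℂ))
    (γ : (Fin m → ℂ) → H) : Prop where
  isOpen : IsOpen V
  holomorphic : AnalyticOnNhd ℂ γ V
  ne_zero : ∀ w ∈ V, γ w ≠ 0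
  span_eq_ker : ∀ w ∈ V,
    Submodule.span ℂ {γ w} = LinearMap.ker (D T w : H →ₗ[ℂ] (Fin m → H))

/-- The Wirtinger derivative `∂f/∂w_i`. -/
def wirtinger (i : Fin m) (f : (Fin m → ℂ) → ℂ) (w : Fin m → ℂ) : ℂ :=
  (1 / 2 : ℂ) *
    (fderiv ℝ f w (Pi.single i 1) - Complex.I * fderiv ℝ f w (Pi.single i Complex.I))

/-- The Wirtinger derivative `∂f/∂w̄_i`. -/
def wirtingerBar (i : Fin m) (f : (Fin m → ℂ) → ℂ) (w : Fin m → ℂ) : ℂ :=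
  (1 / 2 : ℂ) *
    (fderiv ℝ f w (Pi.single i 1) + Complex.I * fderiv ℝ f w (Pi.single i Complex.I))

/-- The curvature matrix, with entries `-∂²/∂w_i∂w̄_j log ‖γ(w)‖²`, computed from the
frame `γ`. -/
def curvature (γ : (Fin m → ℂ) → H) (w : Fin m → ℂ) : Matrix (Fin m) (Fin m) ℂ :=
  Matrix.of fun i j =>
    -wirtinger i (wirtingerBar j fun z => ((Real.log (‖γ z‖ ^ 2) : ℝ) : ℂ)) w

end CowenDouglas

end

/-!
Fix `a ∈ Ω` and let `P` be the orthogonal projection onto `ker D_{T-a}`. Since `D_{T-a}` has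
closed range, `P + ∑ i, (T_i - a_i)^* (T_i - a_i)` is coercive, so `P + ∑ i, (T_i - a_i)^* (T_i -
w_i)` is invertible for `w` near `a`. It agrees with `P` on `ker D_{T-w}`, so applying its inverse
to a unit vector `e ∈ ker D_{T-a}` gives a holomorphic frame `γ` (`MemClass.exists_frame`). This
frame is normalized: `⟪γ a, γ w⟫ = 1` for all `w` near `a`.

Differentiating `(T_i - w_i) γ(w) = 0` gives `N_i(w) ∂_j γ(w) = δ_{ij} γ(w)`, so `𝒩(w)` has the
basis `γ(w), ∂_1 γ(w), …, ∂_m γ(w)` and `N_k(w)` is the rank-one operator `x ↦ ⟪f_k, x⟫ γ(w)`,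
where the `f_k` form the basis dual to the components of the `∂_k γ(w)` orthogonal to `γ(w)`. The
trace matrix is thus `‖γ(w)‖²` times a Gram matrix of the `f_k`, and it is inverse to `‖γ(w)‖⁻²`
times the Gram matrix of those components (`gram_mul_trace_eq_one`), which is minus the transposed
curvature (`curvature_eq_neg_transpose_gramMatrix`).

If the local operators of `T` and `T'` are unitarily equivalent on an open set, the trace
matrices, hence the curvatures, agree there. For normalized frames on a ball this determines the
kernel `K(z, w) = ⟪γ w, γ z⟫` (`inner_eq_inner_of_curvatureNumerator`): the identity `∂_z ∂̄_w log
K = ∂_z ∂̄_w log K'` extends from the diagonal by polarization, and it integrates to `K = K'`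
because both kernels are `1` when one argument is `a`. As the vectors `γ(w)`, for `w` in the ball,
span a dense subspace (`MemClass.dense_span_frame`), `γ(w) ↦ γ'(w)` extends to a unitary, which
intertwines `T` and `T'` since the `γ(w)` are joint eigenvectors with eigenvalues `w`.
-/

noncomputable section

namespace CowenDouglas

open Filter Topology

/-! ### Holomorphic frames -/

section Frames

variable {m : ℕ} {H : Type*} [NormedAddCommGroup H] [InnerProductSpace ℂ H]

theorem mem_ker_D {T : Fin m → H →L[ℂ] H} {w : Fin m → ℂ} {x : H} :
    x ∈ LinearMap.ker (D T w : H →ₗ[ℂ] (Fin m → H)) ↔ ∀ i, shifted T w i x = 0 := by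
  simp [D, funext_iff]

theorem shifted_apply (T : Fin m → H →L[ℂ] H) (w : Fin m → ℂ) (i : Fin m) (x : H) :
    shifted T w i x = T i x - w i • x := by
  simp [shifted]

theorem MemClass.exists_unit_span_eq_ker {Ω : Set (Fin m → ℂ)} {T : Fin m → H →L[ℂ] H}
    (hT : MemClass 1 Ω T) {w : Fin m → ℂ} (hw : w ∈ Ω) :
    ∃ e : H, ‖e‖ = 1 ∧
      Submodule.span ℂ {e} = LinearMap.ker (D T w : H →ₗ[ℂ] (Fin m → H)) := by
  obtain ⟨⟨v, hv⟩, hv0, hspan⟩ := rank_eq_one_iff.mp (by simpa using hT.rank_ker w hw)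
  have hv0' : v ≠ 0 := fun h => hv0 (by ext; exact h)
  refine ⟨((‖v‖⁻¹ : ℝ) : ℂ) • v, ?_, ?_⟩
  · rw [norm_smul]
    simp [hv0']
  · rw [Submodule.span_singleton_smul_eq (by simpa using hv0')]
    refine le_antisymm (by simpa using hv) fun x hx => ?_
    obtain ⟨r, hr⟩ := hspan ⟨x, hx⟩
    exact Submodule.mem_span_singleton.mpr ⟨r, congrArg Subtype.val hr⟩

theorem MemClass.span_eq_ker {Ω : Set (Fin m → ℂ)} {T : Fin m → H →L[ℂ] H}
    (hT : MemClass 1 Ω T) {w : Fin m → ℂ} (hw : w ∈ Ω) {x : H}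
    (hker : LinearMap.ker (D T w : H →ₗ[ℂ] (Fin m → H)) ≤ Submodule.span ℂ {x}) :
    Submodule.span ℂ {x} = LinearMap.ker (D T w : H →ₗ[ℂ] (Fin m → H)) := by
  obtain ⟨e, he, hspan⟩ := hT.exists_unit_span_eq_ker hw
  rw [← hspan] at hker ⊢
  obtain ⟨c, hc⟩ := Submodule.mem_span_singleton.mp (hker (Submodule.mem_span_singleton_self e))
  have hc0 : c ≠ 0 := by
    rintro rfl
    simp [← hc] at he
  rw [← hc, Submodule.span_singleton_smul_eq (IsUnit.mk0 c hc0)]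

variable [CompleteSpace H]

/-- The operator `P + ∑ i, (T_i - a_i)^* (T_i - w_i)`, where `P` is a given bounded operator; it is
used with `P` the orthogonal projection onto `ker D_{T-a}`, and then it is invertible
for `w` near `a`. -/
def frameOp (T : Fin m → H →L[ℂ] H) (P : H →L[ℂ] H) (a w : Fin m → ℂ) : H →L[ℂ] H :=
  P + ∑ i, ContinuousLinearMap.adjoint (shifted T a i) ∘L shifted T w i

theorem analyticOnNhd_frameOp (T : Fin m → H →L[ℂ] H) (P : H →L[ℂ] H) (a : Fin m → ℂ) :
    AnalyticOnNhd ℂ (frameOp T P a) Set.univ := by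
  have key : ∀ i, AnalyticOnNhd ℂ (fun w : Fin m → ℂ =>
      ContinuousLinearMap.adjoint (shifted T a i) ∘L shifted T w i) Set.univ := by
    intro i
    have h1 : AnalyticOnNhd ℂ (fun w : Fin m → ℂ => shifted T w i) Set.univ := by
      unfold shifted
      exact analyticOnNhd_const.sub
        ((ContinuousLinearMap.proj (R := ℂ) (φ := fun _ : Fin m => ℂ) i).analyticOnNhd _ |>.smul
          analyticOnNhd_const)
    exact ((ContinuousLinearMap.compL ℂ H H H
      (ContinuousLinearMap.adjoint (shifted T a i))).analyticOnNhd Set.univ).comp h1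
      (Set.mapsTo_univ _ _)
  unfold frameOp
  exact analyticOnNhd_const.add
    (Finset.univ.analyticOnNhd_fun_sum fun i _ => key i)

/-- Closedness of the range of `D_{T-a}` bounds it below on the orthogonal complement of its
kernel, which makes the quadratic form of `frameOp` coercive. -/
theorem isUnit_frameOp (T : Fin m → H →L[ℂ] H) (a : Fin m → ℂ) (K : Submodule ℂ H)
    [K.HasOrthogonalProjection] (hK : K = LinearMap.ker (D T a : H →ₗ[ℂ] (Fin m → H)))
    (hcl : IsClosed (Set.range (D T a))) :
    IsUnit (frameOp T K.starProjection a a) := by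
  -- `D_{T-a}` restricted to `Kᗮ` is injective and has the same range.
  have hsub : ∀ x : H, D T a (x - K.starProjection x) = D T a x := by
    intro x
    have : K.starProjection x ∈ LinearMap.ker (D T a : H →ₗ[ℂ] (Fin m → H)) :=
      hK ▸ K.starProjection_apply_mem x
    have h0 : D T a (K.starProjection x) = 0 := this
    rw [map_sub, h0, sub_zero]
  have hperp : ∀ x : H, x - K.starProjection x ∈ Kᗮ := fun x =>
    K.sub_starProjection_mem_orthogonal x
  obtain ⟨c, hc⟩ := (D T a ∘L Kᗮ.subtypeL).antilipschitz_of_injective_of_isClosed_range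
    (by
      rw [injective_iff_map_eq_zero]
      rintro ⟨x, hx⟩ h
      have hxK : x ∈ K := by rw [hK]; exact h
      ext
      exact inner_self_eq_zero.mp (hx x hxK))
    (by
      have hrange : Set.range (D T a ∘L Kᗮ.subtypeL) = Set.range (D T a) := by
        ext y
        constructor
        · rintro ⟨x, rfl⟩
          exact ⟨x, rfl⟩
        · rintro ⟨x, rfl⟩
          exact ⟨⟨_, hperp x⟩, hsub x⟩
      rw [hrange]
      exact hcl)
  have hbound : ∀ x : H, ‖x - K.starProjection x‖ ≤ c * ‖D T a x‖ := by
    intro x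
    rw [← hsub x]
    exact hc.le_mul_norm (map_zero _) (⟨_, hperp x⟩ : Kᗮ)
  have hform : ∀ x : H, inner ℂ (frameOp T K.starProjection a a x) x =
      ((‖K.starProjection x‖ ^ 2 + ∑ i, ‖shifted T a i x‖ ^ 2 : ℝ) : ℂ) := by
    intro x
    have h1 : inner ℂ (K.starProjection x) x = ((‖K.starProjection x‖ ^ 2 : ℝ) : ℂ) := by
      have h := hperp x _ (K.starProjection_apply_mem x)
      rw [inner_sub_right, sub_eq_zero] at h
      rw [h, inner_self_eq_norm_sq_to_K]
      push_cast
      rfl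
    have h2 : ∀ i, inner ℂ (ContinuousLinearMap.adjoint (shifted T a i) (shifted T a i x)) x =
        ((‖shifted T a i x‖ ^ 2 : ℝ) : ℂ) := by
      intro i
      rw [ContinuousLinearMap.adjoint_inner_left, inner_self_eq_norm_sq_to_K]
      push_cast
      rfl
    simp only [frameOp, add_apply, inner_add_left, h1,
      sum_apply, sum_inner, ContinuousLinearMap.comp_apply, h2]
    push_cast
    rfl
  have hD : ∀ x : H, ‖D T a x‖ ^ 2 ≤ ∑ i, ‖shifted T a i x‖ ^ 2 := by
    intro x
    have hs : 0 ≤ ∑ i, ‖shifted T a i x‖ ^ 2 := Finset.sum_nonneg fun i _ => sq_nonneg _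
    have : ‖D T a x‖ ≤ Real.sqrt (∑ i, ‖shifted T a i x‖ ^ 2) := by
      rw [pi_norm_le_iff_of_nonneg (Real.sqrt_nonneg _)]
      intro i
      refine Real.le_sqrt_of_sq_le ?_
      exact Finset.single_le_sum (f := fun i => ‖shifted T a i x‖ ^ 2)
        (fun i _ => sq_nonneg _) (Finset.mem_univ i)
    calc ‖D T a x‖ ^ 2 ≤ Real.sqrt (∑ i, ‖shifted T a i x‖ ^ 2) ^ 2 := by gcongr
      _ = _ := Real.sq_sqrt hs
  refine ContinuousLinearMap.isUnit_of_forall_le_norm_inner_map _ (c := (2 * (1 + c ^ 2))⁻¹)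
    (by positivity) fun x => ?_
  rw [hform, Complex.norm_real, Real.norm_of_nonneg (by positivity)]
  have hx : ‖x‖ ≤ ‖K.starProjection x‖ + c * ‖D T a x‖ := by
    calc ‖x‖ = ‖K.starProjection x + (x - K.starProjection x)‖ := by congr 1; abel
      _ ≤ _ := (norm_add_le _ _).trans (by gcongr; exact hbound x)
  have hx2 : ‖x‖ ^ 2 ≤ 2 * (1 + (c : ℝ) ^ 2) * (‖K.starProjection x‖ ^ 2 + ‖D T a x‖ ^ 2) := by
    calc ‖x‖ ^ 2 ≤ (‖K.starProjection x‖ + c * ‖D T a x‖) ^ 2 := by gcongr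
      _ ≤ 2 * (‖K.starProjection x‖ ^ 2 + (c * ‖D T a x‖) ^ 2) := add_sq_le
      _ ≤ _ := by
        have h1 := sq_nonneg ‖K.starProjection x‖
        have h2 := sq_nonneg ‖D T a x‖
        have h3 := sq_nonneg (c : ℝ)
        nlinarith [mul_nonneg h3 h1]
  have hpos : (0 : ℝ) < 2 * (1 + (c : ℝ) ^ 2) := by positivity
  push_cast
  rw [← div_eq_mul_inv, div_le_iff₀ hpos, mul_comm]
  refine hx2.trans ?_
  gcongr
  exact hD x

/-- A holomorphic frame exists near every point `a`; it is obtained by solving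
`frameOp … w (γ w) = e` for a unit vector `e` in `ker D_{T-a}`, and it is then normalized
at `a`: the inner product with `γ a` is constant. -/
theorem MemClass.exists_frame {Ω : Set (Fin m → ℂ)} (hΩ : IsOpen Ω) {T : Fin m → H →L[ℂ] H}
    (hT : MemClass 1 Ω T) {a : Fin m → ℂ} (ha : a ∈ Ω) :
    ∃ (V : Set (Fin m → ℂ)) (γ : (Fin m → ℂ) → H), a ∈ V ∧ V ⊆ Ω ∧ IsHolomorphicFrame T V γ ∧
      ∀ z ∈ V, inner ℂ (γ a) (γ z) = 1 := by
  obtain ⟨e, he, hspan⟩ := hT.exists_unit_span_eq_ker ha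
  set K : Submodule ℂ H := Submodule.span ℂ {e} with hKdef
  set F := frameOp T K.starProjection a with hF
  have hPe : K.starProjection e = e :=
    K.starProjection_eq_self_iff.mpr (Submodule.mem_span_singleton_self e)
  have hee : ∀ i, shifted T a i e = 0 :=
    mem_ker_D.mp (hspan ▸ Submodule.mem_span_singleton_self e)
  have hFan : AnalyticOnNhd ℂ F Set.univ := analyticOnNhd_frameOp T _ a
  have hFa : IsUnit (F a) := isUnit_frameOp T a K hspan (hT.isClosed_range a ha)
  have hVopen : IsOpen {w | IsUnit (F w)} :=
    Units.isOpen.preimage (continuousOn_univ.mp hFan.continuousOn)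
  set γ : (Fin m → ℂ) → H := fun w => Ring.inverse (F w) e with hγ
  have hFγ : ∀ w, IsUnit (F w) → F w (γ w) = e := by
    intro w hw
    have := congrArg (fun A : H →L[ℂ] H => A e) (Ring.mul_inverse_cancel _ hw)
    simpa using this
  have hFe : F a e = e := by
    simp [hF, frameOp, hPe, hee]
  have hγa : γ a = e := by
    have := congrArg (fun A : H →L[ℂ] H => A e) (Ring.inverse_mul_cancel _ hFa)
    simpa [hFe] using this
  have hne : ∀ w, IsUnit (F w) → γ w ≠ 0 := by
    intro w hw h
    have h1 := hFγ w hw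
    rw [h, map_zero] at h1
    simp [← h1] at he
  refine ⟨Ω ∩ {w | IsUnit (F w)}, γ, ⟨ha, hFa⟩, Set.inter_subset_left,
    ⟨hΩ.inter hVopen, ?_, fun w hw => hne w hw.2, ?_⟩, ?_⟩
  · intro w hw
    obtain ⟨u, hu⟩ := hw.2
    have h1 : AnalyticAt ℂ (fun w => Ring.inverse (F w)) w :=
      AnalyticAt.fun_comp (by rw [← hu]; exact analyticAt_inverse u) (hFan w (Set.mem_univ w))
    exact ((ContinuousLinearMap.apply ℂ H e).analyticAt _).fun_comp h1
  · intro w hw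
    refine hT.span_eq_ker hw.1 fun x hx => ?_
    -- On `ker D_{T-w}` the operator `F w` is the projection onto the line spanned by `e`.
    have hFx : F w x = K.starProjection x := by
      simp [hF, frameOp, mem_ker_D.mp hx]
    obtain ⟨c, hc⟩ := Submodule.mem_span_singleton.mp (K.starProjection_apply_mem x)
    refine Submodule.mem_span_singleton.mpr ⟨c, ?_⟩
    have h2 : F w (c • γ w) = F w x := by rw [map_smul, hFγ w hw.2, hc, hFx]
    have h3 := congrArg (fun y => (Ring.inverse (F w) : H →L[ℂ] H) y) h2
    have h4 : ∀ y, (Ring.inverse (F w) : H →L[ℂ] H) (F w y) = y := fun y => by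
      simpa using congrArg (fun A : H →L[ℂ] H => A y) (Ring.inverse_mul_cancel (F w) hw.2)
    simpa only [h4] using h3
  · intro w hw
    -- Pair the equation `F w (γ w) = e` with `e`, which the operators `T_i - a_i` annihilate.
    have h1 : inner ℂ e (F w (γ w)) = inner ℂ e (γ w) := by
      simp only [hF, frameOp, add_apply, inner_add_right,
        sum_apply, inner_sum, ContinuousLinearMap.comp_apply,
        ContinuousLinearMap.adjoint_inner_right, hee, inner_zero_left, Finset.sum_const_zero,
        add_zero]
      rw [← K.inner_starProjection_left_eq_right, hPe]
    rw [hγa, ← h1, hFγ w hw.2, inner_self_eq_norm_sq_to_K, he]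
    simp

end Frames

/-! ### The trace matrix of a tuple of rank-one operators -/

section NilpotentTuple

variable {m : ℕ} {N : Type*} [NormedAddCommGroup N] [InnerProductSpace ℂ N] [CompleteSpace N]

/-- Let `A` be a tuple of operators with values in the line spanned by `g`, with joint kernel that
line, and with `A k (d i) = δ_{ki} g`.  If `e i` is the component of `d i` orthogonal to `g`, then
`A k x = ⟪f k, x⟫ g` where `f` is the basis dual to `e`, so the Gram matrix of `f`, which is
`tr (A k (A j)^*)` up to the factor `‖g‖²`, is inverse to that of `e`. -/
theorem gram_mul_trace_eq_one (A : Fin m → N →L[ℂ] N) (g : N) (d : Fin m → N) (hg : g ≠ 0)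
    (hAg : ∀ k, A k g = 0) (hAd : ∀ k i, A k (d i) = if k = i then g else 0)
    (hker : ∀ x, (∀ k, A k x = 0) → x ∈ Submodule.span ℂ {g})
    (hrange : ∀ k x, A k x ∈ Submodule.span ℂ {g}) :
    (Matrix.of fun k l => inner ℂ (d k) (d l) / inner ℂ g g -
        inner ℂ (d k) g * inner ℂ g (d l) / inner ℂ g g ^ 2 : Matrix (Fin m) (Fin m) ℂ) *
      (Matrix.of fun k j => LinearMap.trace ℂ N
        ((A k ∘L ContinuousLinearMap.adjoint (A j) : N →L[ℂ] N) : N →ₗ[ℂ] N)) = 1 := by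
  set h : ℂ := inner ℂ g g with hh
  have h0 : h ≠ 0 := inner_self_ne_zero.mpr hg
  have hconj : (starRingEnd ℂ) h = h := by rw [hh, inner_conj_symm]
  set f : Fin m → N := fun k => h⁻¹ • ContinuousLinearMap.adjoint (A k) g with hf
  have hf_inner : ∀ k x, inner ℂ (f k) x = inner ℂ g (A k x) / h := by
    intro k x
    rw [hf]
    simp only [inner_smul_left, map_inv₀, hconj, ContinuousLinearMap.adjoint_inner_left]
    field_simp
  clear_value f
  have hA : ∀ k x, A k x = inner ℂ (f k) x • g := by
    intro k x
    obtain ⟨c, hc⟩ := Submodule.mem_span_singleton.mp (hrange k x)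
    rw [hf_inner, ← hc, inner_smul_right, ← hh, mul_div_cancel_right₀ _ h0]
  have hAadj : ∀ j y, ContinuousLinearMap.adjoint (A j) y = inner ℂ g y • f j := by
    intro j y
    refine ext_inner_right ℂ fun x => ?_
    rw [ContinuousLinearMap.adjoint_inner_left, hA, inner_smul_right, inner_smul_left,
      inner_conj_symm, mul_comm]
  have hfd : ∀ k i, inner ℂ (f k) (d i) = if k = i then 1 else 0 := by
    intro k i
    rw [hf_inner, hAd]
    split_ifs
    · exact div_self h0
    · simp
  have hfg : ∀ k, inner ℂ (f k) g = 0 := fun k => by rw [hf_inner, hAg]; simp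
  have hgf : ∀ k, inner ℂ g (f k) = 0 := fun k => by
    rw [← inner_conj_symm, hfg, map_zero]
  have hexp : ∀ x : N, ∃ c : ℂ, x = ∑ l, inner ℂ (f l) x • d l + c • g := by
    intro x
    obtain ⟨c, hc⟩ := Submodule.mem_span_singleton.mp
      (hker (x - ∑ l, inner ℂ (f l) x • d l) fun k => by
        simp only [map_sub, map_sum, map_smul, hAd, hA k x, smul_ite, smul_zero,
          Finset.sum_ite_eq, Finset.mem_univ, if_true, sub_self])
    exact ⟨c, by rw [hc]; abel⟩
  have hfin : Module.Finite ℂ N := by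
    classical
    refine ⟨⟨insert g (Finset.univ.image d), ?_⟩⟩
    rw [eq_top_iff]
    rintro x -
    obtain ⟨c, hc⟩ := hexp x
    rw [hc]
    refine Submodule.add_mem _ (Submodule.sum_mem _ fun l _ => Submodule.smul_mem _ _
      (Submodule.subset_span (by simp))) (Submodule.smul_mem _ _ (Submodule.subset_span (by simp)))
  have htr : ∀ k j, LinearMap.trace ℂ N
      ((A k ∘L ContinuousLinearMap.adjoint (A j) : N →L[ℂ] N) : N →ₗ[ℂ] N) =
      inner ℂ (f k) (f j) * h := by
    intro k j
    have : ((A k ∘L ContinuousLinearMap.adjoint (A j) : N →L[ℂ] N) : N →ₗ[ℂ] N) =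
        (((innerSL ℂ g : N →L[ℂ] ℂ) : N →ₗ[ℂ] ℂ)).smulRight (inner ℂ (f k) (f j) • g) := by
      refine LinearMap.ext fun y => ?_
      change A k (ContinuousLinearMap.adjoint (A j) y) = inner ℂ g y • inner ℂ (f k) (f j) • g
      rw [hAadj, map_smul, hA k]
    rw [this, LinearMap.trace_smulRight]
    simp [hh]
  have hgd : ∀ j, ∃ c : ℂ, f j = ∑ l, inner ℂ (f l) (f j) • d l + c • g ∧
      c * h = - ∑ l, inner ℂ (f l) (f j) * inner ℂ g (d l) := by
    intro j
    obtain ⟨c, hc⟩ := hexp (f j)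
    refine ⟨c, hc, ?_⟩
    have := hgf j
    rw [hc, inner_add_right, inner_sum] at this
    simp only [inner_smul_right] at this
    linear_combination this
  ext k j
  rw [Matrix.mul_apply, Matrix.one_apply]
  simp only [Matrix.of_apply, htr]
  obtain ⟨c, hc, hch⟩ := hgd j
  have h1 : inner ℂ (d k) (f j) = if k = j then 1 else 0 := by
    rw [← inner_conj_symm, hfd]
    by_cases hkj : k = j
    · simp [hkj]
    · simp [hkj, Ne.symm hkj]
  rw [← h1]
  have h2 : inner ℂ (d k) (f j) =
      ∑ l, inner ℂ (f l) (f j) * inner ℂ (d k) (d l) + c * inner ℂ (d k) g := by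
    conv_lhs => rw [hc]
    rw [inner_add_right, inner_sum]
    simp only [inner_smul_right]
  have hc' : c = - (∑ l, inner ℂ (f l) (f j) * inner ℂ g (d l)) / h := by
    rw [← hch, mul_div_cancel_right₀ _ h0]
  rw [h2, hc', neg_div, neg_mul, ← sub_eq_add_neg, Finset.sum_div, Finset.sum_mul,
    ← Finset.sum_sub_distrib]
  refine Finset.sum_congr rfl fun l _ => ?_
  field_simp

end NilpotentTuple

/-! ### The local operators of a holomorphic frame -/

section LocalOperators

variable {m : ℕ} {H : Type*} [NormedAddCommGroup H] [InnerProductSpace ℂ H]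

theorem IsHolomorphicFrame.mono {T : Fin m → H →L[ℂ] H} {V W : Set (Fin m → ℂ)}
    {γ : (Fin m → ℂ) → H} (hγ : IsHolomorphicFrame T V γ) (hWV : W ⊆ V) (hW : IsOpen W) :
    IsHolomorphicFrame T W γ :=
  ⟨hW, hγ.holomorphic.mono hWV, fun w hw => hγ.ne_zero w (hWV hw),
    fun w hw => hγ.span_eq_ker w (hWV hw)⟩

theorem IsHolomorphicFrame.shifted_apply_eq_zero {T : Fin m → H →L[ℂ] H} {V : Set (Fin m → ℂ)}
    {γ : (Fin m → ℂ) → H} (hγ : IsHolomorphicFrame T V γ) {w : Fin m → ℂ} (hw : w ∈ V)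
    (i : Fin m) : shifted T w i (γ w) = 0 :=
  mem_ker_D.mp (hγ.span_eq_ker w hw ▸ Submodule.mem_span_singleton_self (γ w)) i

theorem IsHolomorphicFrame.apply_eq_smul {T : Fin m → H →L[ℂ] H} {V : Set (Fin m → ℂ)}
    {γ : (Fin m → ℂ) → H} (hγ : IsHolomorphicFrame T V γ) {w : Fin m → ℂ} (hw : w ∈ V)
    (i : Fin m) : T i (γ w) = w i • γ w := by
  have := hγ.shifted_apply_eq_zero hw i
  rwa [shifted_apply, sub_eq_zero] at this

theorem IsHolomorphicFrame.hasFDerivAt {T : Fin m → H →L[ℂ] H} {V : Set (Fin m → ℂ)}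
    {γ : (Fin m → ℂ) → H} (hγ : IsHolomorphicFrame T V γ) {w : Fin m → ℂ} (hw : w ∈ V) :
    HasFDerivAt γ (fderiv ℂ γ w) w :=
  (hγ.holomorphic w hw).differentiableAt.hasFDerivAt

/-- Differentiating the eigenvalue equation `T_i γ(z) = z_i γ(z)`. -/
theorem IsHolomorphicFrame.shifted_fderiv {T : Fin m → H →L[ℂ] H} {V : Set (Fin m → ℂ)}
    {γ : (Fin m → ℂ) → H} (hγ : IsHolomorphicFrame T V γ) {w : Fin m → ℂ} (hw : w ∈ V)
    (i : Fin m) (v : Fin m → ℂ) : shifted T w i (fderiv ℂ γ w v) = v i • γ w := by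
  have hd := hγ.hasFDerivAt hw
  have h1 : HasFDerivAt (fun z => T i (γ z)) (T i ∘L fderiv ℂ γ w) w :=
    (T i).hasFDerivAt.comp w hd
  have h2 := ((ContinuousLinearMap.proj (R := ℂ) (φ := fun _ : Fin m => ℂ) i).hasFDerivAt
    (x := w)).smul hd
  have h3 : (fun z => T i (γ z)) =ᶠ[𝓝 w] fun z => z i • γ z :=
    eventually_of_mem (hγ.isOpen.mem_nhds hw) fun z hz => hγ.apply_eq_smul hz i
  have h4 := congrArg (fun L : (Fin m → ℂ) →L[ℂ] H => L v)
    ((h1.congr_of_eventuallyEq h3.symm).unique h2)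
  simp only [ContinuousLinearMap.comp_apply] at h4
  rw [shifted_apply, h4]
  simp

theorem IsHolomorphicFrame.mem_localSpace {T : Fin m → H →L[ℂ] H} {V : Set (Fin m → ℂ)}
    {γ : (Fin m → ℂ) → H} (hγ : IsHolomorphicFrame T V γ) {w : Fin m → ℂ} (hw : w ∈ V) :
    γ w ∈ localSpace T w := by
  rw [CowenDouglas.mem_localSpace]
  intro i j
  rw [hγ.shifted_apply_eq_zero hw, map_zero]

theorem IsHolomorphicFrame.fderiv_mem_localSpace {T : Fin m → H →L[ℂ] H}
    {V : Set (Fin m → ℂ)} {γ : (Fin m → ℂ) → H} (hγ : IsHolomorphicFrame T V γ)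
    {w : Fin m → ℂ} (hw : w ∈ V) (v : Fin m → ℂ) : fderiv ℂ γ w v ∈ localSpace T w := by
  rw [CowenDouglas.mem_localSpace]
  intro i j
  rw [hγ.shifted_fderiv hw, map_smul, hγ.shifted_apply_eq_zero hw, smul_zero]

theorem IsHolomorphicFrame.mem_span {T : Fin m → H →L[ℂ] H} {V : Set (Fin m → ℂ)}
    {γ : (Fin m → ℂ) → H} (hγ : IsHolomorphicFrame T V γ) {w : Fin m → ℂ} (hw : w ∈ V)
    {x : H} (hx : ∀ i, shifted T w i x = 0) : ∃ c : ℂ, c • γ w = x :=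
  Submodule.mem_span_singleton.mp (hγ.span_eq_ker w hw ▸ mem_ker_D.mpr hx)

/-- The matrix with entries `∂_l ∂̄_k log ‖γ‖²`, minus the transpose of the curvature matrix,
written as inner products of `γ` and its first derivatives; up to the factor `‖γ‖⁻²` it is the
Gram matrix of the components of `∂_k γ` orthogonal to `γ`. -/
def gramMatrix (γ : (Fin m → ℂ) → H) (w : Fin m → ℂ) : Matrix (Fin m) (Fin m) ℂ :=
  Matrix.of fun k l =>
    inner ℂ (fderiv ℂ γ w (Pi.single k 1)) (fderiv ℂ γ w (Pi.single l 1)) / inner ℂ (γ w) (γ w) -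
      inner ℂ (fderiv ℂ γ w (Pi.single k 1)) (γ w) *
        inner ℂ (γ w) (fderiv ℂ γ w (Pi.single l 1)) / inner ℂ (γ w) (γ w) ^ 2

theorem IsHolomorphicFrame.gramMatrix_mul_traceMatrix [CompleteSpace H] {T : Fin m → H →L[ℂ] H}
    {V : Set (Fin m → ℂ)} {γ : (Fin m → ℂ) → H} (hγ : IsHolomorphicFrame T V γ)
    {w : Fin m → ℂ} (hw : w ∈ V) : gramMatrix γ w * traceMatrix T w = 1 := by
  refine gram_mul_trace_eq_one (localOp T w) (⟨γ w, hγ.mem_localSpace hw⟩ : localSpace T w)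
    (fun i => ⟨fderiv ℂ γ w (Pi.single i 1), hγ.fderiv_mem_localSpace hw _⟩) ?_ ?_ ?_ ?_ ?_
  · exact fun h => hγ.ne_zero w hw (congrArg Subtype.val h)
  · exact fun k => Subtype.ext (hγ.shifted_apply_eq_zero hw k)
  · intro k i
    ext
    refine (hγ.shifted_fderiv hw k _).trans ?_
    by_cases hki : k = i <;> simp [hki]
  · intro x hx
    obtain ⟨c, hc⟩ := hγ.mem_span hw (x := x) fun i => congrArg Subtype.val (hx i)
    exact Submodule.mem_span_singleton.mpr ⟨c, Subtype.ext hc⟩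
  · intro k x
    obtain ⟨c, hc⟩ := hγ.mem_span hw (x := shifted T w k x)
      fun i => CowenDouglas.mem_localSpace.mp x.2 i k
    exact Submodule.mem_span_singleton.mpr ⟨c, Subtype.ext hc⟩

end LocalOperators

/-! ### The curvature matrix -/

section Curvature

variable {m : ℕ} {H : Type*} [NormedAddCommGroup H] [InnerProductSpace ℂ H]

theorem single_I (i : Fin m) :
    (Pi.single i Complex.I : Fin m → ℂ) = Complex.I • Pi.single i (1 : ℂ) := by
  rw [← Pi.single_smul]
  simp

theorem hasFDerivAt_real_inner {f g : (Fin m → ℂ) → H} {f' g' : (Fin m → ℂ) →L[ℂ] H}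
    {w : Fin m → ℂ} (hf : HasFDerivAt f f' w) (hg : HasFDerivAt g g' w) :
    ∃ L : (Fin m → ℂ) →L[ℝ] ℂ, HasFDerivAt (fun z => inner ℂ (f z) (g z)) L w ∧
      ∀ v, L v = inner ℂ (f w) (g' v) + inner ℂ (f' v) (g w) :=
  ⟨_, (hf.restrictScalars ℝ).inner ℂ (hg.restrictScalars ℝ), fun v => by simp⟩

theorem hasFDerivAt_real_comp {f : (Fin m → ℂ) → ℂ} {L : (Fin m → ℂ) →L[ℝ] ℂ} {w : Fin m → ℂ}
    {φ : ℂ → ℂ} {c : ℂ} (hφ : HasDerivAt φ c (f w)) (hf : HasFDerivAt f L w) :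
    ∃ M : (Fin m → ℂ) →L[ℝ] ℂ, HasFDerivAt (fun z => φ (f z)) M w ∧ ∀ v, M v = c * L v :=
  ⟨_, (hφ.hasFDerivAt.restrictScalars ℝ).comp w hf, fun v => by simp [mul_comm]⟩

theorem wirtingerBar_log_norm_sq {γ : (Fin m → ℂ) → H} {γ' : (Fin m → ℂ) →L[ℂ] H}
    {w : Fin m → ℂ} (hγ : HasFDerivAt γ γ' w) (h0 : γ w ≠ 0) (j : Fin m) :
    wirtingerBar j (fun z => ((Real.log (‖γ z‖ ^ 2) : ℝ) : ℂ)) w =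
      inner ℂ (γ' (Pi.single j 1)) (γ w) / inner ℂ (γ w) (γ w) := by
  have hlog : (fun z => ((Real.log (‖γ z‖ ^ 2) : ℝ) : ℂ)) =
      fun z => Complex.log (inner ℂ (γ z) (γ z)) := by
    funext z
    rw [Complex.ofReal_log (by positivity), inner_self_eq_norm_sq_to_K]
    push_cast
    rfl
  obtain ⟨L, hL, hLv⟩ := hasFDerivAt_real_inner hγ hγ
  have hslit : inner ℂ (γ w) (γ w) ∈ Complex.slitPlane := by
    rw [inner_self_eq_norm_sq_to_K]
    have : (0 : ℝ) < ‖γ w‖ ^ 2 := by positivity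
    exact_mod_cast Complex.ofReal_mem_slitPlane.mpr this
  obtain ⟨M, hM, hMv⟩ := hasFDerivAt_real_comp (Complex.hasDerivAt_log hslit) hL
  rw [wirtingerBar, hlog, hM.fderiv, single_I]
  simp only [hMv, hLv, map_smul, inner_smul_right, inner_smul_left, Complex.conj_I]
  linear_combination (1 / 2 * (inner ℂ (γ w) (γ w))⁻¹ *
    (inner ℂ (γ w) (γ' (Pi.single j 1)) - inner ℂ (γ' (Pi.single j 1)) (γ w))) * Complex.I_mul_I

/-- Differentiate `log ‖γ‖²` twice: a Wirtinger derivative of an inner product of holomorphic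
functions only sees one of the two factors. -/
theorem curvature_eq_neg_transpose_gramMatrix [CompleteSpace H] {V : Set (Fin m → ℂ)}
    (hV : IsOpen V) {γ : (Fin m → ℂ) → H} (hγ : AnalyticOnNhd ℂ γ V) (h0 : ∀ z ∈ V, γ z ≠ 0)
    {w : Fin m → ℂ} (hw : w ∈ V) : curvature γ w = -(gramMatrix γ w).transpose := by
  ext i j
  have hd : ∀ z ∈ V, HasFDerivAt γ (fderiv ℂ γ z) z := fun z hz =>
    (hγ z hz).differentiableAt.hasFDerivAt
  obtain ⟨β, hβ⟩ : ∃ β : (Fin m → ℂ) →L[ℂ] H,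
      HasFDerivAt (fun z => fderiv ℂ γ z (Pi.single j 1)) β w :=
    ⟨_, ((ContinuousLinearMap.apply ℂ H (Pi.single j (1 : ℂ) : Fin m → ℂ)).hasFDerivAt).comp w
      ((hγ.fderiv w hw).differentiableAt.hasFDerivAt)⟩
  have hbar : (wirtingerBar j fun z => ((Real.log (‖γ z‖ ^ 2) : ℝ) : ℂ)) =ᶠ[𝓝 w]
      fun z => inner ℂ (fderiv ℂ γ z (Pi.single j 1)) (γ z) * (inner ℂ (γ z) (γ z))⁻¹ :=
    eventually_of_mem (hV.mem_nhds hw) fun z hz => by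
      rw [wirtingerBar_log_norm_sq (hd z hz) (h0 z hz), div_eq_mul_inv]
  have hne : inner ℂ (γ w) (γ w) ≠ 0 := inner_self_ne_zero.mpr (h0 w hw)
  obtain ⟨L, hL, hLv⟩ := hasFDerivAt_real_inner (hd w hw) (hd w hw)
  obtain ⟨M, hM, hMv⟩ := hasFDerivAt_real_comp (hasDerivAt_inv hne) hL
  obtain ⟨P, hP, hPv⟩ := hasFDerivAt_real_inner hβ (hd w hw)
  simp only [curvature, Matrix.of_apply, Matrix.neg_apply, Matrix.transpose_apply, gramMatrix]
  rw [wirtinger, hbar.fderiv_eq, (hP.fun_mul hM).fderiv, single_I]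
  simp only [add_apply, smul_apply, smul_eq_mul, hMv, hPv, hLv, map_smul, inner_smul_right,
    inner_smul_left, Complex.conj_I]
  field_simp
  ring_nf
  simp only [Complex.I_sq]
  ring

theorem IsHolomorphicFrame.neg_transpose_curvature [CompleteSpace H] {T : Fin m → H →L[ℂ] H}
    {V : Set (Fin m → ℂ)} {γ : (Fin m → ℂ) → H} (hγ : IsHolomorphicFrame T V γ)
    {w : Fin m → ℂ} (hw : w ∈ V) : -(curvature γ w).transpose = gramMatrix γ w := by
  rw [curvature_eq_neg_transpose_gramMatrix hγ.isOpen hγ.holomorphic hγ.ne_zero hw]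
  simp

theorem IsHolomorphicFrame.isUnit_curvature [CompleteSpace H] {T : Fin m → H →L[ℂ] H}
    {V : Set (Fin m → ℂ)} {γ : (Fin m → ℂ) → H} (hγ : IsHolomorphicFrame T V γ)
    {w : Fin m → ℂ} (hw : w ∈ V) : IsUnit (curvature γ w) := by
  have h := IsUnit.of_mul_eq_one _ (hγ.gramMatrix_mul_traceMatrix hw)
  rw [curvature_eq_neg_transpose_gramMatrix hγ.isOpen hγ.holomorphic hγ.ne_zero hw]
  exact ((Matrix.isUnit_transpose _).mpr h).neg

theorem IsHolomorphicFrame.inv_neg_transpose_curvature [CompleteSpace H]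
    {T : Fin m → H →L[ℂ] H} {V : Set (Fin m → ℂ)} {γ : (Fin m → ℂ) → H}
    (hγ : IsHolomorphicFrame T V γ) {w : Fin m → ℂ} (hw : w ∈ V) :
    (-(curvature γ w).transpose)⁻¹ = traceMatrix T w := by
  rw [hγ.neg_transpose_curvature hw]
  exact Matrix.inv_eq_right_inv (hγ.gramMatrix_mul_traceMatrix hw)

end Curvature

/-! ### Unitary invariance -/

section UnitaryInvariance

variable {m : ℕ} {H H' : Type*} [NormedAddCommGroup H] [InnerProductSpace ℂ H]
  [NormedAddCommGroup H'] [InnerProductSpace ℂ H']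

theorem traceMatrix_eq_of_unitarilyEquivalent [CompleteSpace H] [CompleteSpace H']
    {T : Fin m → H →L[ℂ] H} {T' : Fin m → H' →L[ℂ] H'} {w : Fin m → ℂ}
    (h : UnitarilyEquivalent (localOp T w) (localOp T' w)) :
    traceMatrix T w = traceMatrix T' w := by
  obtain ⟨U, hU⟩ := h
  ext k j
  simp only [traceMatrix, Matrix.of_apply]
  rw [← LinearMap.trace_conj' _ U.toLinearEquiv]
  congr 1
  have hadj : ∀ y, U (ContinuousLinearMap.adjoint (localOp T w j) (U.symm y)) =
      ContinuousLinearMap.adjoint (localOp T' w j) y := by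
    intro y
    refine ext_inner_right ℂ fun x => ?_
    obtain ⟨x, rfl⟩ := U.surjective x
    rw [ContinuousLinearMap.adjoint_inner_left, U.inner_map_map,
      ContinuousLinearMap.adjoint_inner_left, ← U.inner_map_map, hU, U.apply_symm_apply]
  refine LinearMap.ext fun y => ?_
  change U (localOp T w k (ContinuousLinearMap.adjoint (localOp T w j) (U.symm y))) =
    localOp T' w k (ContinuousLinearMap.adjoint (localOp T' w j) y)
  rw [hU, hadj]

theorem UnitarilyEquivalent.localOp {T : Fin m → H →L[ℂ] H} {T' : Fin m → H' →L[ℂ] H'}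
    (h : UnitarilyEquivalent T T') (w : Fin m → ℂ) :
    UnitarilyEquivalent (localOp T w) (localOp T' w) := by
  obtain ⟨U, hU⟩ := h
  have hs : ∀ i x, U (shifted T w i x) = shifted T' w i (U x) := fun i x => by
    simp only [shifted_apply, map_sub, map_smul, hU]
  have hmap : (localSpace T w).map (U.toLinearEquiv : H →ₗ[ℂ] H') = localSpace T' w := by
    ext y
    obtain ⟨x, rfl⟩ := U.surjective y
    rw [mem_localSpace]
    constructor
    · rintro ⟨z, hz, hzx⟩
      obtain rfl : z = x := U.injective hzx
      intro i j
      rw [← hs, ← hs, mem_localSpace.mp hz, map_zero]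
    · intro hx
      refine ⟨x, mem_localSpace.mpr fun i j => U.injective ?_, rfl⟩
      rw [hs, hs, hx, map_zero]
  refine ⟨(U.submoduleMap (localSpace T w)).trans (LinearIsometryEquiv.ofEq _ _ hmap), ?_⟩
  intro k x
  ext
  exact hs k x

end UnitaryInvariance

/-! ### Polarization of sesquiholomorphic kernels -/

section Polarization

variable {E : Type*} [NormedAddCommGroup E] [NormedSpace ℂ E]

/-- The kernel `G z w` is holomorphic in `z` and antiholomorphic in `w` on `V × V`; this is tested
along pairs of complex lines, the second one run through by the conjugate of the parameter of the
first. -/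
def IsSesquiholomorphicOn (V : Set E) (G : E → E → ℂ) : Prop :=
  ∀ (a b c d : E) (s : ℂ), a + s • b ∈ V → c + (starRingEnd ℂ) s • d ∈ V →
    DifferentiableAt ℂ (fun s : ℂ => G (a + s • b) (c + (starRingEnd ℂ) s • d)) s

theorem IsSesquiholomorphicOn.mul {V : Set E} {G K : E → E → ℂ}
    (hG : IsSesquiholomorphicOn V G) (hK : IsSesquiholomorphicOn V K) :
    IsSesquiholomorphicOn V fun z w => G z w * K z w :=
  fun a b c d s h1 h2 => (hG a b c d s h1 h2).fun_mul (hK a b c d s h1 h2)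

theorem IsSesquiholomorphicOn.sub {V : Set E} {G K : E → E → ℂ}
    (hG : IsSesquiholomorphicOn V G) (hK : IsSesquiholomorphicOn V K) :
    IsSesquiholomorphicOn V fun z w => G z w - K z w :=
  fun a b c d s h1 h2 => (hG a b c d s h1 h2).fun_sub (hK a b c d s h1 h2)

theorem isSesquiholomorphicOn_inner {H : Type*} [NormedAddCommGroup H] [InnerProductSpace ℂ H]
    {V : Set E} {f g : E → H} (hf : ∀ z ∈ V, DifferentiableAt ℂ f z)
    (hg : ∀ z ∈ V, DifferentiableAt ℂ g z) :
    IsSesquiholomorphicOn V fun z w => inner ℂ (f w) (g z) := by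
  intro a b c d s h1 h2
  have hgs : HasFDerivAt (fun s : ℂ => g (a + s • b)) _ s :=
    ((hg _ h1).hasFDerivAt.restrictScalars ℝ).comp s
      (((hasFDerivAt_id (𝕜 := ℝ) s).smul_const b).const_add a)
  have hfs : HasFDerivAt (fun s : ℂ => f (c + (starRingEnd ℂ) s • d)) _ s :=
    ((hf _ h2).hasFDerivAt.restrictScalars ℝ).comp s
      ((((Complex.conjCLE : ℂ →L[ℝ] ℂ).hasFDerivAt (x := s)).smul_const d).const_add c)
  have hL := hfs.inner ℂ hgs
  refine (hasFDerivAt_of_restrictScalars ℝ hL (f' := ContinuousLinearMap.toSpanSingleton ℂ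
    (inner ℂ (f (c + (starRingEnd ℂ) s • d)) (fderiv ℂ g (a + s • b) b) +
      inner ℂ (fderiv ℂ f (c + (starRingEnd ℂ) s • d) d) (g (a + s • b)))) ?_).differentiableAt
  ext v
  simp [inner_smul_left, inner_smul_right]
  ring

/-- A sesquiholomorphic kernel that vanishes on the diagonal of a convex open set vanishes.
With `c` the midpoint of `z` and `w` and `d = (z - w) / 2`, the function
`s ↦ G (c + s d) (c - s̄ d)` is holomorphic, its value at `1` is `G z w`, and on the imaginary axis
it is evaluated on the diagonal. -/
theorem IsSesquiholomorphicOn.eq_zero_of_diagonal {V : Set E} (hV : IsOpen V) (hconv : Convex ℝ V)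
    {G : E → E → ℂ} (hG : IsSesquiholomorphicOn V G) (hdiag : ∀ z ∈ V, G z z = 0)
    {z w : E} (hz : z ∈ V) (hw : w ∈ V) : G z w = 0 := by
  set c : E := (1 / 2 : ℝ) • z + (1 / 2 : ℝ) • w with hc
  set d : E := (1 / 2 : ℝ) • z - (1 / 2 : ℝ) • w with hd
  have hcd : c + d = z := by
    rw [hc, hd, add_add_sub_cancel, ← add_smul]
    norm_num
  have hcd' : c - d = w := by
    rw [hc, hd, add_sub_sub_cancel, ← add_smul]
    norm_num
  have hcV : c ∈ V := hconv hz hw (by norm_num) (by norm_num) (by norm_num)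
  set p : ℂ → E := fun s => c + s • d with hp
  set q : ℂ → E := fun s => c + (starRingEnd ℂ) s • -d with hq
  have hpc : Continuous p := by fun_prop
  have hqc : Continuous q := by
    have := Complex.continuous_conj
    fun_prop
  set S : Set ℂ := p ⁻¹' V ∩ q ⁻¹' V with hS
  have hSopen : IsOpen S := (hV.preimage hpc).inter (hV.preimage hqc)
  have hSconv : Convex ℝ S := by
    intro s hs t ht α β hα hβ hαβ
    have hα' : α = 1 - β := by linarith
    constructor
    · have : p (α • s + β • t) = α • p s + β • p t := by
        simp only [hp, hα', Complex.ofReal_sub, Complex.ofReal_one, ← Complex.coe_smul]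
        module
      rw [Set.mem_preimage, this]
      exact hconv hs.1 ht.1 hα hβ hαβ
    · have : q (α • s + β • t) = α • q s + β • q t := by
        simp only [hq, hα', Complex.ofReal_sub, Complex.ofReal_one,
          ← Complex.coe_smul, smul_eq_mul, map_add, map_mul, map_sub, map_one, Complex.conj_ofReal]
        module
      rw [Set.mem_preimage, this]
      exact hconv hs.2 ht.2 hα hβ hαβ
  have hdiff : DifferentiableOn ℂ (fun s => G (p s) (q s)) S := fun s hs =>
    (hG c d c (-d) s hs.1 hs.2).differentiableWithinAt
  have h0S : (0 : ℂ) ∈ S := by simp [hS, hp, hq, hcV]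
  have h1S : (1 : ℂ) ∈ S := by
    simp only [hS, hp, hq, Set.mem_inter_iff, Set.mem_preimage, one_smul, map_one,
      ← sub_eq_add_neg, hcd, hcd']
    exact ⟨hz, hw⟩
  have hfreq : ∃ᶠ s in 𝓝[≠] (0 : ℂ), G (p s) (q s) = 0 := by
    have htend : Tendsto (fun t : ℝ => (t : ℂ) * Complex.I) (𝓝[≠] 0) (𝓝[≠] 0) := by
      refine tendsto_nhdsWithin_of_tendsto_nhds_of_eventually_within _ ?_ ?_
      · have : Continuous fun t : ℝ => (t : ℂ) * Complex.I := by fun_prop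
        simpa using (this.tendsto 0).mono_left nhdsWithin_le_nhds
      · filter_upwards [self_mem_nhdsWithin] with t ht
        simpa using ht
    have hev : ∀ᶠ t : ℝ in 𝓝[≠] 0, G (p (t * Complex.I)) (q (t * Complex.I)) = 0 := by
      filter_upwards [htend.eventually
        (mem_nhdsWithin_of_mem_nhds (hSopen.mem_nhds h0S))] with t ht
      have hpq : q (t * Complex.I) = p (t * Complex.I) := by
        simp [hp, hq]
      rw [hpq]
      exact hdiag _ ht.1
    exact htend.frequently hev.frequently
  have := (hdiff.analyticOnNhd hSopen).eqOn_zero_of_preconnected_of_frequently_eq_zero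
    hSconv.isPreconnected h0S hfreq h1S
  simpa [hp, hq, ← sub_eq_add_neg, hcd, hcd'] using this

end Polarization

/-! ### Rigidity of normalized kernels -/

section Rigidity

variable {E : Type*} [NormedAddCommGroup E] [NormedSpace ℂ E]

/-- Two quotients of holomorphic functions with the same derivative, by the quotient rule, and the
same value at one point agree. -/
theorem div_eq_div_of_hasFDerivAt {V : Set E} (hV : IsOpen V) (hconn : IsPreconnected V)
    {f g f₁ g₁ : E → ℂ} {f' g' f₁' g₁' : E → E →L[ℂ] ℂ}
    (hf : ∀ z ∈ V, HasFDerivAt f (f' z) z) (hg : ∀ z ∈ V, HasFDerivAt g (g' z) z)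
    (hf₁ : ∀ z ∈ V, HasFDerivAt f₁ (f₁' z) z) (hg₁ : ∀ z ∈ V, HasFDerivAt g₁ (g₁' z) z)
    (hg0 : ∀ z ∈ V, g z ≠ 0) (hg₁0 : ∀ z ∈ V, g₁ z ≠ 0)
    (heq : ∀ z ∈ V, ∀ u, (f' z u * g z - f z * g' z u) * g₁ z ^ 2 =
      (f₁' z u * g₁ z - f₁ z * g₁' z u) * g z ^ 2)
    {a : E} (ha : a ∈ V) (hfa : f a / g a = f₁ a / g₁ a) {z : E} (hz : z ∈ V) :
    f z / g z = f₁ z / g₁ z := by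
  have hd : ∀ z ∈ V, HasFDerivAt (fun z => f z * (g z)⁻¹ - f₁ z * (g₁ z)⁻¹) (0 : E →L[ℂ] ℂ) z := by
    intro z hz
    have hginv := (hasDerivAt_inv (hg0 z hz)).comp_hasFDerivAt z (hg z hz)
    have hg₁inv := (hasDerivAt_inv (hg₁0 z hz)).comp_hasFDerivAt z (hg₁ z hz)
    refine (((hf z hz).mul hginv).sub ((hf₁ z hz).mul hg₁inv)).congr_fderiv ?_
    ext u
    have h0 := hg0 z hz
    have h1 := hg₁0 z hz
    have h2 := heq z hz u
    simp only [Function.comp_apply, sub_apply, add_apply, smul_apply, smul_eq_mul, zero_apply]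
    field_simp
    linear_combination h2
  have := hV.is_const_of_fderiv_eq_zero hconn
    (fun z hz => (hd z hz).differentiableAt.differentiableWithinAt)
    (fun z hz => (hd z hz).fderiv) hz ha
  simp only [← div_eq_mul_inv] at this
  rw [hfa, sub_self] at this
  exact sub_eq_zero.mp this

variable {H H' : Type*} [NormedAddCommGroup H] [InnerProductSpace ℂ H]
  [NormedAddCommGroup H'] [InnerProductSpace ℂ H']

theorem hasFDerivAt_inner_const {γ : E → H} {V : Set E} (hγ : AnalyticOnNhd ℂ γ V) (x : H)
    {z : E} (hz : z ∈ V) :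
    HasFDerivAt (fun z => inner ℂ x (γ z)) (innerSL ℂ x ∘L fderiv ℂ γ z) z :=
  (innerSL ℂ x).hasFDerivAt.comp z (hγ z hz).differentiableAt.hasFDerivAt

/-- The numerator `K ∂_u ∂̄_v K - ∂_u K ∂̄_v K` of the mixed derivative `∂_u ∂̄_v log K` of the
kernel `K(z, w) = ⟪γ w, γ z⟫`, off the diagonal. -/
def curvatureNumerator (γ : E → H) (u v z w : E) : ℂ :=
  inner ℂ (fderiv ℂ γ w v) (fderiv ℂ γ z u) * inner ℂ (γ w) (γ z) -
    inner ℂ (fderiv ℂ γ w v) (γ z) * inner ℂ (γ w) (fderiv ℂ γ z u)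

/-- For a frame normalized at `a`, the antiholomorphic derivatives of the kernel in the second
variable vanish when the first one is `a`. -/
theorem inner_fderiv_eq_zero_of_normalized {γ : E → H} {V : Set E} (hV : IsOpen V)
    (hγ : AnalyticOnNhd ℂ γ V) {a : E} (hn : ∀ z ∈ V, inner ℂ (γ a) (γ z) = 1)
    {w : E} (hw : w ∈ V) (v : E) : inner ℂ (fderiv ℂ γ w v) (γ a) = 0 := by
  have h1 : HasFDerivAt (fun z => inner ℂ (γ a) (γ z)) (0 : E →L[ℂ] ℂ) w :=
    (hasFDerivAt_const (1 : ℂ) w).congr_of_eventuallyEq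
      (eventually_of_mem (hV.mem_nhds hw) hn)
  have h2 := congrArg (fun L : E →L[ℂ] ℂ => L v)
    ((hasFDerivAt_inner_const hγ (γ a) hw).unique h1)
  rw [← inner_conj_symm]
  exact (congrArg (starRingEnd ℂ) h2).trans (by simp)

theorem curvatureNumerator_diagonal {m : ℕ} (γ : (Fin m → ℂ) → H) (u v z : Fin m → ℂ)
    (hz : γ z ≠ 0) :
    curvatureNumerator γ u v z z = (∑ k, ∑ l, (starRingEnd ℂ) (v k) * u l * gramMatrix γ z k l) *
      inner ℂ (γ z) (γ z) ^ 2 := by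
  have hsum : ∀ u : Fin m → ℂ,
      fderiv ℂ γ z u = ∑ l, u l • fderiv ℂ γ z (Pi.single l 1) := by
    intro u
    conv_lhs => rw [← Finset.univ_sum_single u]
    rw [map_sum]
    refine Finset.sum_congr rfl fun l _ => ?_
    rw [← map_smul, ← Pi.single_smul, smul_eq_mul, mul_one]
  have hne : inner ℂ (γ z) (γ z) ≠ 0 := inner_self_ne_zero.mpr hz
  rw [curvatureNumerator, hsum u, hsum v]
  simp only [sum_inner, inner_sum, inner_smul_left, inner_smul_right]
  simp only [Finset.sum_mul, Finset.mul_sum, ← Finset.sum_sub_distrib]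
  rw [Finset.sum_comm]
  refine Finset.sum_congr rfl fun k _ => Finset.sum_congr rfl fun l _ => ?_
  rw [gramMatrix, Matrix.of_apply]
  field_simp

variable [CompleteSpace H] [CompleteSpace H']

theorem isSesquiholomorphicOn_curvatureNumerator {V : Set E} {γ : E → H}
    (hγ : AnalyticOnNhd ℂ γ V) (u v : E) :
    IsSesquiholomorphicOn V (curvatureNumerator γ u v) := by
  have h0 : ∀ z ∈ V, DifferentiableAt ℂ γ z := fun z hz => (hγ z hz).differentiableAt
  have h1 : ∀ v, ∀ z ∈ V, DifferentiableAt ℂ (fun z => fderiv ℂ γ z v) z := fun v z hz =>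
    (hγ.fderiv z hz).differentiableAt.clm_apply (differentiableAt_const v)
  exact ((isSesquiholomorphicOn_inner (h1 v) (h1 u)).mul (isSesquiholomorphicOn_inner h0 h0)).sub
    ((isSesquiholomorphicOn_inner (h1 v) h0).mul (isSesquiholomorphicOn_inner h0 (h1 u)))

/-- Calabi rigidity: two kernels normalized at `a` with the same curvature on the diagonal are
equal.  By polarization the mixed derivatives of `log K` and `log K'` agree off the diagonal as
well, and the normalization allows them to be integrated in one variable and then in the other. -/
theorem inner_eq_inner_of_curvatureNumerator {V : Set E} (hV : IsOpen V) (hconv : Convex ℝ V)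
    {γ : E → H} {γ' : E → H'} (hγ : AnalyticOnNhd ℂ γ V) (hγ' : AnalyticOnNhd ℂ γ' V)
    {a : E} (ha : a ∈ V)
    (hn : ∀ z ∈ V, inner ℂ (γ a) (γ z) = 1) (hn' : ∀ z ∈ V, inner ℂ (γ' a) (γ' z) = 1)
    (h0 : ∀ z ∈ V, ∀ w ∈ V, inner ℂ (γ w) (γ z) ≠ 0)
    (h0' : ∀ z ∈ V, ∀ w ∈ V, inner ℂ (γ' w) (γ' z) ≠ 0)
    (hcurv : ∀ u v, ∀ z ∈ V, curvatureNumerator γ u v z z * inner ℂ (γ' z) (γ' z) ^ 2 =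
      curvatureNumerator γ' u v z z * inner ℂ (γ z) (γ z) ^ 2)
    {z w : E} (hz : z ∈ V) (hw : w ∈ V) : inner ℂ (γ w) (γ z) = inner ℂ (γ' w) (γ' z) := by
  have hK : IsSesquiholomorphicOn V fun z w => inner ℂ (γ w) (γ z) :=
    isSesquiholomorphicOn_inner (fun z hz => (hγ z hz).differentiableAt)
      (fun z hz => (hγ z hz).differentiableAt)
  have hK' : IsSesquiholomorphicOn V fun z w => inner ℂ (γ' w) (γ' z) :=
    isSesquiholomorphicOn_inner (fun z hz => (hγ' z hz).differentiableAt)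
      (fun z hz => (hγ' z hz).differentiableAt)
  have hpol : ∀ u v, ∀ z ∈ V, ∀ w ∈ V,
      curvatureNumerator γ u v z w * inner ℂ (γ' w) (γ' z) ^ 2 =
        curvatureNumerator γ' u v z w * inner ℂ (γ w) (γ z) ^ 2 := by
    intro u v z hz w hw
    have := (((isSesquiholomorphicOn_curvatureNumerator hγ u v).mul (hK'.mul hK')).sub
      ((isSesquiholomorphicOn_curvatureNumerator hγ' u v).mul (hK.mul hK))).eq_zero_of_diagonal
      hV hconv (fun z hz => by linear_combination hcurv u v z hz) hz hw
    linear_combination this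
  have hconn := hconv.isPreconnected
  -- Integrating in `z` from `a`, where both sides vanish, gives equality of `∂̄_w log K` and
  -- `∂̄_w log K'`.
  have hlog : ∀ z ∈ V, ∀ w ∈ V, ∀ v,
      inner ℂ (fderiv ℂ γ w v) (γ z) / inner ℂ (γ w) (γ z) =
        inner ℂ (fderiv ℂ γ' w v) (γ' z) / inner ℂ (γ' w) (γ' z) := by
    intro z hz w hw v
    refine div_eq_div_of_hasFDerivAt hV hconn
      (fun z hz => hasFDerivAt_inner_const hγ _ hz) (fun z hz => hasFDerivAt_inner_const hγ _ hz)
      (fun z hz => hasFDerivAt_inner_const hγ' _ hz)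
      (fun z hz => hasFDerivAt_inner_const hγ' _ hz)
      (fun z hz => h0 z hz w hw) (fun z hz => h0' z hz w hw) (fun z hz u => ?_) ha ?_ hz
    · exact hpol u v z hz w hw
    · rw [inner_fderiv_eq_zero_of_normalized hV hγ hn hw,
        inner_fderiv_eq_zero_of_normalized hV hγ' hn' hw, zero_div, zero_div]
  -- Equality of `∂̄_w log K` and `∂̄_w log K'`, conjugated, says that this quotient has
  -- derivative zero.
  have hconj : ∀ z ∈ V, ∀ w ∈ V, inner ℂ (γ z) (γ w) / inner ℂ (γ' z) (γ' w) = 1 := by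
    intro z hz w hw
    have h := div_eq_div_of_hasFDerivAt hV hconn (f₁ := fun _ => 1) (g₁ := fun _ => 1)
      (fun w hw => hasFDerivAt_inner_const hγ (γ z) hw)
      (fun w hw => hasFDerivAt_inner_const hγ' (γ' z) hw)
      (fun w _ => hasFDerivAt_const 1 w) (fun w _ => hasFDerivAt_const 1 w)
      (fun w hw => h0' w hw z hz) (fun _ _ => one_ne_zero) (fun w hw v => ?_) ha ?_ hw
    · simpa using h
    · have h1 := hlog z hz w hw v
      rw [div_eq_div_iff (h0 z hz w hw) (h0' z hz w hw)] at h1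
      have h2 := congrArg (starRingEnd ℂ) h1
      simp only [map_mul, inner_conj_symm] at h2
      simp only [ContinuousLinearMap.comp_apply, innerSL_apply_apply, zero_apply]
      linear_combination h2
    · rw [← inner_conj_symm, hn z hz, ← inner_conj_symm (γ' z), hn' z hz]
      simp
  exact (div_eq_one_iff_eq (h0' z hz w hw)).mp (hconj w hw z hz)

end Rigidity

/-! ### The global unitary -/

section Unitary

variable {m : ℕ} {H H' : Type*} [NormedAddCommGroup H] [InnerProductSpace ℂ H] [CompleteSpace H]
  [NormedAddCommGroup H'] [InnerProductSpace ℂ H'] [CompleteSpace H']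

/-- The joint eigenvectors over any non-empty open subset already span a dense subspace: a vector
orthogonal to them is orthogonal to all joint eigenvectors by the identity theorem. -/
theorem MemClass.dense_span_frame {Ω : Set (Fin m → ℂ)} (hΩ : IsOpen Ω) (hconn : IsConnected Ω)
    {T : Fin m → H →L[ℂ] H} (hT : MemClass 1 Ω T) {V : Set (Fin m → ℂ)} (hVΩ : V ⊆ Ω)
    {a : Fin m → ℂ} (ha : a ∈ V) {γ : (Fin m → ℂ) → H} (hγ : IsHolomorphicFrame T V γ) :
    Dense (Submodule.span ℂ (γ '' V) : Set H) := by
  rw [Submodule.dense_iff_topologicalClosure_eq_top, Submodule.topologicalClosure_eq_top_iff,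
    Submodule.eq_bot_iff]
  intro x hx
  set u : Set (Fin m → ℂ) := {w | ∀ᶠ z in 𝓝 w,
    ∀ y ∈ LinearMap.ker (D T z : H →ₗ[ℂ] (Fin m → H)), inner ℂ x y = 0} with hu
  have hau : a ∈ u := eventually_of_mem (hγ.isOpen.mem_nhds ha) fun z hz y hy => by
    obtain ⟨c, rfl⟩ := hγ.mem_span hz (mem_ker_D.mp hy)
    rw [inner_smul_right, ← inner_conj_symm,
      hx (γ z) (Submodule.subset_span (Set.mem_image_of_mem γ hz)), map_zero, mul_zero]
  have hclosed : closure u ∩ Ω ⊆ u := by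
    rintro w ⟨hwu, hwΩ⟩
    obtain ⟨W, δ, hwW, -, hδ, -⟩ := hT.exists_frame hΩ hwΩ
    obtain ⟨r, hr, hrW⟩ := Metric.isOpen_iff.mp hδ.isOpen w hwW
    have hwr : Metric.ball w r ∈ 𝓝 w := Metric.ball_mem_nhds w hr
    obtain ⟨z₀, hz₀r, hz₀u⟩ := mem_closure_iff_nhds.mp hwu _ hwr
    have han : AnalyticOnNhd ℂ (fun z => inner ℂ x (δ z)) (Metric.ball w r) := fun z hz =>
      ((innerSL ℂ x).analyticAt _).fun_comp (hδ.holomorphic z (hrW hz))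
    have hz : (fun z => inner ℂ x (δ z)) =ᶠ[𝓝 z₀] 0 := by
      filter_upwards [hz₀u, Metric.isOpen_ball.mem_nhds hz₀r] with z hz hzr
      exact hz _ (mem_ker_D.mpr (hδ.shifted_apply_eq_zero (hrW hzr)))
    have hzero := han.eqOn_zero_of_preconnected_of_eventuallyEq_zero
      (convex_ball w r).isPreconnected hz₀r hz
    refine eventually_of_mem hwr fun z hz y hy => ?_
    obtain ⟨c, rfl⟩ := hδ.mem_span (hrW hz) (mem_ker_D.mp hy)
    rw [inner_smul_right, show inner ℂ x (δ z) = 0 from hzero hz, mul_zero]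
  have hsub : Ω ⊆ u := hconn.isPreconnected.subset_of_closure_inter_subset
    isOpen_setOfPred_eventually_nhds ⟨a, hVΩ ha, hau⟩ hclosed
  have horth : (⨆ w ∈ Ω, LinearMap.ker (D T w : H →ₗ[ℂ] (Fin m → H)) : Submodule ℂ H) ≤
      LinearMap.ker (innerSL ℂ x : H →ₗ[ℂ] ℂ) :=
    iSup₂_le fun w hw y hy => (hsub hw).self_of_nhds y hy
  have hzero : innerSL ℂ x = 0 := by
    refine ContinuousLinearMap.ext fun y => ?_
    refine hT.dense_span.induction (P := fun y => innerSL ℂ x y = (0 : H →L[ℂ] ℂ) y)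
      (fun y hy => horth hy) (isClosed_eq (by fun_prop) (by fun_prop)) y
  exact inner_self_eq_zero.mp (congrArg (fun L : H →L[ℂ] ℂ => L x) hzero)

/-- Two families of vectors with dense spans and the same Gram matrix correspond under
a unitary. -/
theorem exists_unitary_of_inner_eq {ι : Type*} (f : ι → H) (g : ι → H')
    (hf : Dense (Submodule.span ℂ (Set.range f) : Set H))
    (hg : Dense (Submodule.span ℂ (Set.range g) : Set H'))
    (hfg : ∀ i j, inner ℂ (f i) (f j) = inner ℂ (g i) (g j)) :
    ∃ U : H ≃ₗᵢ[ℂ] H', ∀ i, U (f i) = g i := by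
  rw [← Finsupp.range_linearCombination] at hf hg
  have hinner : ∀ c : ι →₀ ℂ,
      inner ℂ (Finsupp.linearCombination ℂ g c) (Finsupp.linearCombination ℂ g c) =
      inner ℂ (Finsupp.linearCombination ℂ f c) (Finsupp.linearCombination ℂ f c) := by
    intro c
    simp only [Finsupp.linearCombination_apply, Finsupp.sum, sum_inner, inner_sum,
      inner_smul_left, inner_smul_right, hfg]
  have hnorm : ∀ c : ι →₀ ℂ, ‖Finsupp.linearCombination ℂ g (LinearEquiv.refl ℂ (ι →₀ ℂ) c)‖ =
      ‖Finsupp.linearCombination ℂ f c‖ := by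
    intro c
    have h := congrArg Complex.re (hinner c)
    rw [LinearEquiv.refl_apply, @norm_eq_sqrt_re_inner ℂ, @norm_eq_sqrt_re_inner ℂ]
    exact congrArg Real.sqrt h
  refine ⟨(LinearEquiv.refl ℂ (ι →₀ ℂ)).extendOfIsometry (Finsupp.linearCombination ℂ f)
    (Finsupp.linearCombination ℂ g) hf hg hnorm, fun i => ?_⟩
  have := LinearEquiv.extendOfIsometry_eq (LinearEquiv.refl ℂ (ι →₀ ℂ))
    (Finsupp.linearCombination ℂ f) (Finsupp.linearCombination ℂ g) hf hg
    hnorm (Finsupp.single i 1)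
  simpa using this

theorem unitarilyEquivalent_of_inner_frame_eq {Ω : Set (Fin m → ℂ)} (hΩ : IsOpen Ω)
    (hconn : IsConnected Ω) {T : Fin m → H →L[ℂ] H} {T' : Fin m → H' →L[ℂ] H'}
    (hT : MemClass 1 Ω T) (hT' : MemClass 1 Ω T') {V : Set (Fin m → ℂ)} (hVΩ : V ⊆ Ω)
    {a : Fin m → ℂ} (ha : a ∈ V) {γ : (Fin m → ℂ) → H} {γ' : (Fin m → ℂ) → H'}
    (hγ : IsHolomorphicFrame T V γ) (hγ' : IsHolomorphicFrame T' V γ')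
    (heq : ∀ z ∈ V, ∀ w ∈ V, inner ℂ (γ w) (γ z) = inner ℂ (γ' w) (γ' z)) :
    UnitarilyEquivalent T T' := by
  have hd := hT.dense_span_frame hΩ hconn hVΩ ha hγ
  have hd' := hT'.dense_span_frame hΩ hconn hVΩ ha hγ'
  rw [Set.image_eq_range] at hd hd'
  obtain ⟨U, hU⟩ := exists_unitary_of_inner_eq (fun z : V => γ z) (fun z : V => γ' z) hd hd'
    fun i j => heq j j.2 i i.2
  refine ⟨U, fun k => ?_⟩
  have : (U.toContinuousLinearEquiv : H →L[ℂ] H') ∘L T k =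
      T' k ∘L (U.toContinuousLinearEquiv : H →L[ℂ] H') := by
    refine ContinuousLinearMap.ext_on hd ?_
    rintro _ ⟨z, rfl⟩
    change U (T k (γ z)) = T' k (U (γ z))
    have hUz : U (γ z) = γ' z := hU z
    rw [hγ.apply_eq_smul z.2, map_smul, hUz, hγ'.apply_eq_smul z.2]
  exact fun x => congrArg (fun L : H →L[ℂ] H' => L x) this

/-- Unitarily equivalent local operators have the same trace matrix, hence the normalized frames
have the same curvature on a ball, and by Calabi rigidity the same kernel there. -/
theorem unitarilyEquivalent_of_localOp {Ω : Set (Fin m → ℂ)} (hΩ : IsOpen Ω)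
    (hconn : IsConnected Ω) {T : Fin m → H →L[ℂ] H} {T' : Fin m → H' →L[ℂ] H'}
    (hT : MemClass 1 Ω T) (hT' : MemClass 1 Ω T') {U : Set (Fin m → ℂ)} (hU : IsOpen U)
    (hUΩ : U ⊆ Ω) {a : Fin m → ℂ} (ha : a ∈ U)
    (hloc : ∀ w ∈ U, UnitarilyEquivalent (localOp T w) (localOp T' w)) :
    UnitarilyEquivalent T T' := by
  obtain ⟨V, γ, haV, -, hγ, hn⟩ := hT.exists_frame hΩ (hUΩ ha)
  obtain ⟨V', γ', haV', -, hγ', hn'⟩ := hT'.exists_frame hΩ (hUΩ ha)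
  have hc : ContinuousAt (fun p : (Fin m → ℂ) × (Fin m → ℂ) => inner ℂ (γ p.1) (γ p.2)) (a, a) :=
    ((hγ.holomorphic a haV).continuousAt.comp' continuousAt_fst).inner
      ((hγ.holomorphic a haV).continuousAt.comp' continuousAt_snd)
  have hc' : ContinuousAt (fun p : (Fin m → ℂ) × (Fin m → ℂ) => inner ℂ (γ' p.1) (γ' p.2))
      (a, a) :=
    ((hγ'.holomorphic a haV').continuousAt.comp' continuousAt_fst).inner
      ((hγ'.holomorphic a haV').continuousAt.comp' continuousAt_snd)
  have hne := hc.eventually_ne (y := 0) (by rw [hn a haV]; exact one_ne_zero)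
  have hne' := hc'.eventually_ne (y := 0) (by rw [hn' a haV']; exact one_ne_zero)
  rw [nhds_prod_eq] at hne hne'
  obtain ⟨B, hB, hBne⟩ := eventually_prod_self_iff'.mp (hne.and hne')
  obtain ⟨r, hr, hball⟩ := Metric.mem_nhds_iff.mp (inter_mem (inter_mem (hU.mem_nhds ha) hB)
    (inter_mem (hγ.isOpen.mem_nhds haV) (hγ'.isOpen.mem_nhds haV')))
  have hγr := hγ.mono (fun z hz => (hball hz).2.1) (Metric.isOpen_ball (x := a) (ε := r))
  have hγr' := hγ'.mono (fun z hz => (hball hz).2.2) (Metric.isOpen_ball (x := a) (ε := r))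
  have har : a ∈ Metric.ball a r := Metric.mem_ball_self hr
  refine unitarilyEquivalent_of_inner_frame_eq hΩ hconn hT hT'
    (fun z hz => hUΩ (hball hz).1.1) har hγr hγr' fun z hz w hw =>
    inner_eq_inner_of_curvatureNumerator Metric.isOpen_ball (convex_ball a r) hγr.holomorphic
      hγr'.holomorphic har (fun z hz => hn z (hball hz).2.1) (fun z hz => hn' z (hball hz).2.2)
      (fun z hz w hw => (hBne w (hball hw).1.2 z (hball hz).1.2).1)
      (fun z hz w hw => (hBne w (hball hw).1.2 z (hball hz).1.2).2) (fun u v z hz => ?_) hz hw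
  -- Both are the left inverse of the common trace matrix.
  have hgram : gramMatrix γ z = gramMatrix γ' z := by
    rw [← Matrix.inv_eq_left_inv (hγr.gramMatrix_mul_traceMatrix hz),
      ← Matrix.inv_eq_left_inv (hγr'.gramMatrix_mul_traceMatrix hz),
      traceMatrix_eq_of_unitarilyEquivalent (hloc z (hball hz).1.1)]
  rw [curvatureNumerator_diagonal γ u v z (hγr.ne_zero z hz),
    curvatureNumerator_diagonal γ' u v z (hγr'.ne_zero z hz), hgram]
  ring

end Unitary

end CowenDouglas

end

theorem mainTheorem4 {m : ℕ} {H H' : Type*}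
    [NormedAddCommGroup H] [InnerProductSpace ℂ H] [CompleteSpace H]
    [TopologicalSpace.SeparableSpace H]
    [NormedAddCommGroup H'] [InnerProductSpace ℂ H'] [CompleteSpace H']
    [TopologicalSpace.SeparableSpace H']
    (Ω : Set (Fin m → ℂ)) (hΩ_open : IsOpen Ω) (hΩ_conn : IsConnected Ω)
    (hΩ_bdd : Bornology.IsBounded Ω)
    (T : Fin m → H →L[ℂ] H) (T' : Fin m → H' →L[ℂ] H')
    (hT : CowenDouglas.MemClass 1 Ω T) (hT' : CowenDouglas.MemClass 1 Ω T') :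
    (CowenDouglas.UnitarilyEquivalent T T' ↔
      ∃ U : Set (Fin m → ℂ), IsOpen U ∧ U.Nonempty ∧ U ⊆ Ω ∧
        ∀ w ∈ U, CowenDouglas.UnitarilyEquivalent
          (CowenDouglas.localOp T w) (CowenDouglas.localOp T' w)) ∧
    (∀ w ∈ Ω, ∃ (V : Set (Fin m → ℂ)) (γ : (Fin m → ℂ) → H),
      w ∈ V ∧ V ⊆ Ω ∧ CowenDouglas.IsHolomorphicFrame T V γ) ∧
    (∀ (V : Set (Fin m → ℂ)) (γ : (Fin m → ℂ) → H),
      V ⊆ Ω → CowenDouglas.IsHolomorphicFrame T V γ → ∀ w ∈ V,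
        IsUnit (CowenDouglas.curvature γ w) ∧
        (-(CowenDouglas.curvature γ w).transpose)⁻¹ = CowenDouglas.traceMatrix T w) := by
  refine ⟨⟨fun h => ⟨Ω, hΩ_open, hΩ_conn.nonempty, subset_rfl, fun w _ => h.localOp w⟩, ?_⟩, ?_, ?_⟩
  · rintro ⟨U, hU, ⟨a, ha⟩, hUΩ, hloc⟩
    exact CowenDouglas.unitarilyEquivalent_of_localOp hΩ_open hΩ_conn hT hT' hU hUΩ ha hloc
  · intro w hw
    obtain ⟨V, γ, hwV, hVΩ, hγ, -⟩ := hT.exists_frame hΩ_open hw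
    exact ⟨V, γ, hwV, hVΩ, hγ⟩
  · exact fun V γ _ hγ w hw => ⟨hγ.isUnit_curvature hw, hγ.inv_neg_transpose_curvature hw⟩
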